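/- Let $\alpha,\beta\in \mathrm{SL}_2(\mathbb{R})$ be such that $(\operatorname{Tr}\alpha,\operatorname{Tr}\beta,\operatorname{Tr}\alpha\beta)$ is one of the following triples: - case I: $(\sqrt5,\,2\sqrt5,\,5)$; - case II: $(\sqrt6,\,2\sqrt3,\,3\sqrt2)$; - case III: $(2\sqrt2,\,2\sqrt2,\,4)$. Let $\Gamma=\langle \alpha,\beta,-1\rangle\subset \mathrm{SL}_2(\mathbb{R})$ be the inverse image of the subgroup of $\mathrm{PSL}_2(\mathbb{R})$ generated by the images of $\alpha$ and $\beta$, and let $\Gamma^{(2)}=\langle\gamma^2:\gamma\in\Gamma\rangle$. Put $$\Gamma'=\langle\Gamma^{(2)},\alpha\beta,-1\rangle\ \text{ in cases I and III},\qquad \Gamma'=\langle\Gamma^{(2)},-1\rangle\ \text{ in case II}.$$ Let $\mathbb{Z}[\Gamma']\subset M_2(\mathbb{R})$ be the subring (equivalently, the $\mathbb{Z}$-submodule) generated by $\Gamma'$, and let $\mathbb{Z}[\Gamma']^1=\{x\in\mathbb{Z}[\Gamma'] : \det x=1\}$. Then in each of the cases I, II, III $$\mathbb{Z}[\Gamma']^1=\Gamma'.$$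 -/

import Mathlib

namespace OnePuncturedTorus

open Matrix

/-- The traces of `α`, `β` and `α β` are `x`, `y` and `z`. -/
def HasTraces (α β : SpecialLinearGroup (Fin 2) ℝ) (x y z : ℝ) : Prop :=
  (α : Matrix (Fin 2) (Fin 2) ℝ).trace = x ∧
  (β : Matrix (Fin 2) (Fin 2) ℝ).trace = y ∧
  ((α * β : SpecialLinearGroup (Fin 2) ℝ) : Matrix (Fin 2) (Fin 2) ℝ).trace = z

/-- The full inverse image in `SL₂(ℝ)` of the image of `H` in `PSL₂(ℝ)`, that is, `± H`. -/
def saturate (H : Subgroup (SpecialLinearGroup (Fin 2) ℝ)) :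
    Subgroup (SpecialLinearGroup (Fin 2) ℝ) :=
  H ⊔ Subgroup.closure {-1}

/-- The inverse image `Γ` in `SL₂(ℝ)` of the subgroup of `PSL₂(ℝ)` generated by the images of
`α` and `β`. -/
def Gam (α β : SpecialLinearGroup (Fin 2) ℝ) : Subgroup (SpecialLinearGroup (Fin 2) ℝ) :=
  saturate (Subgroup.closure {α, β})

/-- The group `Γ⁽²⁾` generated by the squares of the elements of `Γ`. -/
def GamSq (α β : SpecialLinearGroup (Fin 2) ℝ) : Subgroup (SpecialLinearGroup (Fin 2) ℝ) :=
  Subgroup.closure {g | ∃ γ ∈ Gam α β, g = γ ^ 2}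

/-- The subring `ℤ[H]` of `M₂(ℝ)` generated by the elements of `H`. Since `H` is closed under
products, this is also the `ℤ`-module generated by `H`. -/
def groupOrder (H : Subgroup (SpecialLinearGroup (Fin 2) ℝ)) :
    Subring (Matrix (Fin 2) (Fin 2) ℝ) :=
  Subring.closure ((fun g : SpecialLinearGroup (Fin 2) ℝ => (g : Matrix (Fin 2) (Fin 2) ℝ)) '' H)

/-- The elements of reduced norm (that is, determinant) `1` of a subring of `M₂(ℝ)`. -/
def normOne (O : Subring (Matrix (Fin 2) (Fin 2) ℝ)) : Set (Matrix (Fin 2) (Fin 2) ℝ) :=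
  {x | x ∈ O ∧ x.det = 1}

/-- The equality `ℤ[H]¹ = H`, as an equality of sets of matrices. -/
def NormOneEqSelf (H : Subgroup (SpecialLinearGroup (Fin 2) ℝ)) : Prop :=
  normOne (groupOrder H) =
    (fun g : SpecialLinearGroup (Fin 2) ℝ => (g : Matrix (Fin 2) (Fin 2) ℝ)) '' H

end OnePuncturedTorus

open Matrix

namespace OnePuncturedTorus

-- The traces satisfy x² + y² + z² = xyz, so the commutator of `α` and `β` has trace -2, not 2; the
-- pair is then determined by its traces up to conjugacy (`exists_conj_of_trace_eq`). It can be
-- replaced by integral matrices `A`, `B` proportional to it, the scalars being square roots of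
-- integers. In this model `Γ'` is shown to be the whole norm one group of an explicit congruence
-- order `O` in M₂(ℤ). This suffices: ℤ[Γ'] then lies in the conjugate of `O`, so its elements of
-- determinant 1 lie in `Γ'` (`normOneEqSelf_of_eq_map`).
--
-- Upper bound: `A` and `B` normalize `O`, whose norm one group contains the rescaled `A²`, `B²` and
-- (AB)². Modulo that group `α` and `β` generate a quotient of the Klein four-group, so all squares
-- from `Γ` lie in it (`GamSq_le`). In cases I and III `αβ` is itself integral in the model; in case
-- II its trace is irrational and only its square is used.
--
-- Lower bound: a finite coset table for SL₂(ℤ) shows that a few elements of `Γ'` generate the norm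
-- one group of `O` (`le_of_cosetTable`).

local notation "M2Z" => Matrix (Fin 2) (Fin 2) ℤ
local notation "M2R" => Matrix (Fin 2) (Fin 2) ℝ
local notation "SL2Z" => SpecialLinearGroup (Fin 2) ℤ
local notation "SL2R" => SpecialLinearGroup (Fin 2) ℝ

/-! ### Squares in an extension of a group by a Klein four-group -/

section Group

variable {G : Type*} [Group G]

/-- Let `a` and `b` conjugate the subgroup `U` into itself, and let `a²`, `b²`, `(ab)²` lie in `U`.
Then `U` contains the squares of all elements of the subgroup generated by `a`, `b` and `U`. -/
theorem sq_mem_of_mem_closure {U : Subgroup G} {a b : G}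
    (ha : ∀ u ∈ U, a * u * a⁻¹ ∈ U) (hb : ∀ u ∈ U, b * u * b⁻¹ ∈ U)
    (ha2 : a ^ 2 ∈ U) (hb2 : b ^ 2 ∈ U) (hab2 : (a * b) ^ 2 ∈ U)
    {g : G} (hg : g ∈ Subgroup.closure {a, b} ⊔ U) : g ^ 2 ∈ U := by
  have ha' : ∀ u ∈ U, a⁻¹ * u * a ∈ U := fun u hu => by
    have := mul_mem (mul_mem (inv_mem ha2) (ha u hu)) ha2
    rwa [show (a ^ 2)⁻¹ * (a * u * a⁻¹) * a ^ 2 = a⁻¹ * u * a by group] at this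
  -- With the three squares in `U`, so is the commutator: `a` and `b` commute modulo `U`.
  have hc : b * a * b⁻¹ * a⁻¹ ∈ U := by
    have h1 := hb _ hab2
    have h2 := ha' _ (inv_mem hb2)
    have := mul_mem (mul_mem h1 h2) (inv_mem ha2)
    rwa [show b * (a * b) ^ 2 * b⁻¹ * (a⁻¹ * (b ^ 2)⁻¹ * a) * (a ^ 2)⁻¹ = b * a * b⁻¹ * a⁻¹ by
      simp only [pow_two]; group] at this
  -- The four cosets of `1`, `a`, `b`, `ab`; stability under left multiplication makes them exhaust
  -- the generated group.
  let T : Set G := {g | ∃ u ∈ U, g = u ∨ g = u * a ∨ g = u * b ∨ g = u * (a * b)}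
  have hUT : ∀ u ∈ U, ∀ g ∈ T, u * g ∈ T := by
    rintro u hu g ⟨w, hw, h⟩
    refine ⟨u * w, mul_mem hu hw, ?_⟩
    rcases h with rfl | rfl | rfl | rfl <;> simp [mul_assoc]
  have haT : ∀ g ∈ T, a * g ∈ T := by
    rintro g ⟨u, hu, h | h | h | h⟩ <;> rw [h]
    · exact ⟨_, ha u hu, by right; left; group⟩
    · exact ⟨_, mul_mem (ha u hu) ha2, by left; group⟩
    · exact ⟨_, ha u hu, by right; right; right; group⟩
    · exact ⟨_, mul_mem (ha u hu) ha2, by right; right; left; group⟩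
  have hbT : ∀ g ∈ T, b * g ∈ T := by
    rintro g ⟨u, hu, h | h | h | h⟩ <;> rw [h]
    · exact ⟨_, hb u hu, by right; right; left; group⟩
    · exact ⟨_, mul_mem (hb u hu) hc, by right; right; right; group⟩
    · exact ⟨_, mul_mem (hb u hu) hb2, by left; group⟩
    · exact ⟨_, mul_mem (mul_mem (hb u hu) hc) (ha _ hb2), by right; left; group⟩
  have key : g ∈ T := by
    rw [← Subgroup.closure_eq U, ← Subgroup.closure_union] at hg
    induction hg using Subgroup.closure_induction_left with
    | one => exact ⟨1, one_mem _, by simp⟩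
    | mul_left x hx y _ hy =>
      rcases hx with (rfl | rfl) | hx
      exacts [haT y hy, hbT y hy, hUT x hx y hy]
    | inv_mul_cancel x hx y _ hy =>
      rcases hx with (rfl | rfl) | hx
      · rw [show x⁻¹ * y = (x ^ 2)⁻¹ * (x * y) by group]
        exact hUT _ (inv_mem ha2) _ (haT y hy)
      · rw [show x⁻¹ * y = (x ^ 2)⁻¹ * (x * y) by group]
        exact hUT _ (inv_mem hb2) _ (hbT y hy)
      · exact hUT _ (inv_mem hx) y hy
  obtain ⟨u, hu, rfl | rfl | rfl | rfl⟩ := key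
  · exact pow_mem hu 2
  · rw [show (u * a) ^ 2 = u * (a * u * a⁻¹) * a ^ 2 by
      simp only [pow_two]; group]
    exact mul_mem (mul_mem hu (ha u hu)) ha2
  · rw [show (u * b) ^ 2 = u * (b * u * b⁻¹) * b ^ 2 by
      simp only [pow_two]; group]
    exact mul_mem (mul_mem hu (hb u hu)) hb2
  · rw [show (u * (a * b)) ^ 2 = u * (a * (b * u * b⁻¹) * a⁻¹) * (a * b) ^ 2 by
      simp only [pow_two]; group]
    exact mul_mem (mul_mem hu (ha _ (hb u hu))) hab2

end Group

/-! ### Conjugacy from traces, and transport of norm one groups -/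

section Conjugation

/-- A pair of matrices of determinant one whose commutator does not have trace two, the first with
an eigenvalue `l`, has a normal form determined by the traces and `l`. -/
theorem exists_normal_form {A B : M2R} (hA : A.det = 1) (hB : B.det = 1) {l : ℝ}
    (hl : l ^ 2 - A.trace * l + 1 = 0)
    (hirr : A.trace ^ 2 + B.trace ^ 2 + (A * B).trace ^ 2
      - A.trace * B.trace * (A * B).trace ≠ 4) :
    ∃ P : M2Rˣ,
      A * P = P * !![l, B.trace * l + (A * B).trace - A.trace * B.trace; 0, A.trace - l] ∧
      B * P = P * !![0, -1; 1, B.trace] := by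
  have hchar : (A - l • (1 : M2R)).det = 0 := by
    rw [← hl, ← hA, det_fin_two, det_fin_two, trace_fin_two]
    simp
    ring
  obtain ⟨v, hv0, hv⟩ := exists_mulVec_eq_zero_iff.mpr hchar
  have hAv : A *ᵥ v = l • v := by
    rwa [sub_mulVec, smul_mulVec, one_mulVec, sub_eq_zero] at hv
  -- `v` and `Bv` form a basis: otherwise `v` is a common eigenvector, so det(AB - BA) = 0. But this
  -- determinant is 2 minus the trace of the commutator, that is 4 - (x² + y² + z² - xyz).
  have hdet : v 0 * (B *ᵥ v) 1 - (B *ᵥ v) 0 * v 1 ≠ 0 := by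
    intro h
    obtain ⟨m, hm⟩ : ∃ m : ℝ, B *ᵥ v = m • v := by
      by_cases h0 : v 0 = 0
      · have h1 : v 1 ≠ 0 := fun h1 => hv0 (by ext i; fin_cases i <;> simp [h0, h1])
        refine ⟨(B *ᵥ v) 1 / v 1, ?_⟩
        have : (B *ᵥ v) 0 = 0 := by simpa [h0, h1] using h
        ext i
        fin_cases i
        · simp [this, h0]
        · simp [h1]
      · refine ⟨(B *ᵥ v) 0 / v 0, ?_⟩
        ext i
        fin_cases i
        · simp [h0]
        · simp only [Pi.smul_apply, smul_eq_mul, Fin.mk_one]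
          field_simp
          linarith
    have hcomm : (A * B - B * A).det = 0 := by
      refine exists_mulVec_eq_zero_iff.mp ⟨v, hv0, ?_⟩
      rw [sub_mulVec, ← mulVec_mulVec, ← mulVec_mulVec, hm, hAv, mulVec_smul, mulVec_smul, hAv, hm,
        smul_comm, sub_self]
    apply hirr
    rw [det_fin_two] at hA hB hcomm
    simp only [trace_fin_two, mul_apply, Fin.sum_univ_two, Matrix.sub_apply] at hcomm ⊢
    linear_combination -hcomm + (4 * (B 0 0 * B 1 1 - B 0 1 * B 1 0) -
      (B 0 0 + B 1 1) ^ 2) * hA + (4 - (A 0 0 + A 1 1) ^ 2) * hB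
  -- In the basis `v`, `Bv` the matrix of `B` is a companion matrix by Cayley–Hamilton, and the
  -- trace of `AB` fixes the last entry of `A`.
  let P : M2R := !![v 0, (B *ᵥ v) 0; v 1, (B *ᵥ v) 1]
  have hP : IsUnit P := by
    rw [isUnit_iff_isUnit_det, det_fin_two_of, isUnit_iff_ne_zero]
    exact hdet
  refine ⟨hP.unit, ?_, ?_⟩
  · have h0 := congrFun hAv 0
    have h1 := congrFun hAv 1
    simp only [mulVec, dotProduct, Fin.sum_univ_two, Pi.smul_apply, smul_eq_mul] at h0 h1
    ext i j
    fin_cases i <;> fin_cases j <;>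
      simp [P, mulVec, dotProduct, mul_apply, Fin.sum_univ_two, trace_fin_two]
    · linear_combination h0
    · linear_combination (B 1 1) * h0 - B 0 1 * h1
    · linear_combination h1
    · linear_combination -(B 1 0) * h0 + B 0 0 * h1
  · rw [det_fin_two] at hB
    ext i j
    fin_cases i <;> fin_cases j <;>
      simp [P, mulVec, dotProduct, mul_apply, Fin.sum_univ_two, trace_fin_two]
    · linear_combination -(v 0) * hB
    · linear_combination -(v 1) * hB

/-- Two pairs of matrices of determinant one with the same traces are conjugate. -/
theorem exists_conj_of_trace_eq {A B A' B' : M2R} (hA : A.det = 1) (hB : B.det = 1)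
    (hA' : A'.det = 1) (hB' : B'.det = 1) (htA : A.trace = A'.trace) (htB : B.trace = B'.trace)
    (htAB : (A * B).trace = (A' * B').trace) (hyp : 4 ≤ A.trace ^ 2)
    (hirr : A.trace ^ 2 + B.trace ^ 2 + (A * B).trace ^ 2
      - A.trace * B.trace * (A * B).trace ≠ 4) :
    ∃ P : M2Rˣ, A = P * A' * (P⁻¹ : M2Rˣ) ∧ B = P * B' * (P⁻¹ : M2Rˣ) := by
  -- The larger root of the characteristic polynomial, real by `hyp`.
  have hl : ((A.trace + √(A.trace ^ 2 - 4)) / 2) ^ 2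
      - A.trace * ((A.trace + √(A.trace ^ 2 - 4)) / 2) + 1 = 0 := by
    linear_combination (1 / 4 : ℝ) * Real.sq_sqrt (sub_nonneg.mpr hyp)
  obtain ⟨P, h1, h2⟩ := exists_normal_form hA hB hl hirr
  rw [htA, htB, htAB] at hirr
  rw [htA] at hl
  obtain ⟨Q, h3, h4⟩ := exists_normal_form hA' hB' hl hirr
  rw [htA, htB, htAB] at h1
  rw [htB] at h2
  refine ⟨P * Q⁻¹, ?_, ?_⟩
  · rw [_root_.mul_inv_rev, inv_inv, Units.val_mul, Units.val_mul, mul_assoc, mul_assoc, ← mul_assoc A', h3,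
      mul_assoc, Units.inv_mul_cancel_left, ← mul_assoc, ← h1, Units.mul_inv_cancel_right]
  · rw [_root_.mul_inv_rev, inv_inv, Units.val_mul, Units.val_mul, mul_assoc, mul_assoc, ← mul_assoc B', h4,
      mul_assoc, Units.inv_mul_cancel_left, ← mul_assoc, ← h2, Units.mul_inv_cancel_right]

/-- Conjugation by `P` as a ring homomorphism from integral to real matrices. -/
noncomputable def intConj (P : M2Rˣ) : M2Z →+* M2R :=
  (MulSemiringAction.toRingHom (ConjAct M2Rˣ) M2R (ConjAct.toConjAct P)).comp
    (Int.castRingHom ℝ).mapMatrix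

theorem intConj_apply (P : M2Rˣ) (m : M2Z) :
    intConj P m = P * m.map (Int.cast : ℤ → ℝ) * (P⁻¹ : M2Rˣ) := rfl

theorem det_intConj (P : M2Rˣ) (m : M2Z) : (intConj P m).det = m.det := by
  rw [intConj_apply, det_units_conj]
  exact (RingHom.map_det (Int.castRingHom ℝ) m).symm

/-- Conjugation by `P` as a homomorphism from `SL₂(ℤ)` to `SL₂(ℝ)`. -/
noncomputable def slConj (P : M2Rˣ) : SL2Z →* SL2R where
  toFun m := ⟨intConj P m.1, by rw [det_intConj, m.2, Int.cast_one]⟩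
  map_one' := Subtype.ext (map_one (intConj P))
  map_mul' m n := Subtype.ext (map_mul (intConj P) m.1 n.1)

theorem coe_slConj (P : M2Rˣ) (m : SL2Z) : (slConj P m : M2R) = intConj P m := rfl

/-- The group of elements of determinant one of a ring of integral matrices. -/
def unitsNormOne (O : Subring M2Z) : Subgroup SL2Z where
  carrier := {m | (m : M2Z) ∈ O}
  one_mem' := O.one_mem
  mul_mem' h h' := O.mul_mem h h'
  inv_mem' {m} h := by
    have hinv : ((m⁻¹ : SL2Z) : M2Z) = (m : M2Z).adjugate := Matrix.SpecialLinearGroup.coe_inv m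
    -- By Cayley–Hamilton the inverse is an integral combination of `1` and `m`, so every subring
    -- contains it.
    have hadj : (m : M2Z).adjugate = (m : M2Z).trace • (1 : M2Z) - m := by
      rw [adjugate_fin_two, trace_fin_two]
      ext i j
      fin_cases i <;> fin_cases j <;> simp [-zsmul_eq_mul, -zsmul_one]
    change ((m⁻¹ : SL2Z) : M2Z) ∈ O
    rw [hinv, hadj]
    exact O.sub_mem (zsmul_mem O.one_mem _) h

theorem mem_unitsNormOne {O : Subring M2Z} {m : SL2Z} : m ∈ unitsNormOne O ↔ (m : M2Z) ∈ O :=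
  Iff.rfl

theorem exists_slConj_eq {P : M2Rˣ} {g : SL2R} {m : M2Z} (h : (g : M2R) = intConj P m) :
    ∃ k : SL2Z, (k : M2Z) = m ∧ slConj P k = g := by
  have hdet : m.det = 1 := by
    have := det_intConj P m
    rw [← h, g.2] at this
    exact_mod_cast this.symm
  exact ⟨⟨m, hdet⟩, rfl, Subtype.ext h.symm⟩

theorem mem_map_slConj {P : M2Rˣ} {O : Subring M2Z} {g : SL2R} {m : M2Z} (hm : m ∈ O)
    (h : (g : M2R) = intConj P m) : g ∈ (unitsNormOne O).map (slConj P) := by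
  obtain ⟨k, rfl, rfl⟩ := exists_slConj_eq h
  exact ⟨k, hm, rfl⟩

/-- If `H` is conjugate to the group of norm one elements of an order, it is the group of norm one
elements of the order that it generates. -/
theorem normOneEqSelf_of_eq_map {P : M2Rˣ} {O : Subring M2Z} {H : Subgroup SL2R}
    (h : H = (unitsNormOne O).map (slConj P)) : NormOneEqSelf H := by
  apply Set.Subset.antisymm
  · rintro x ⟨hx, hdet⟩
    have hle : groupOrder H ≤ O.map (intConj P) := by
      refine Subring.closure_le.mpr ?_
      rintro _ ⟨g, hg, rfl⟩
      rw [h] at hg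
      obtain ⟨m, hm, rfl⟩ := hg
      exact ⟨m, hm, rfl⟩
    obtain ⟨m, hm, rfl⟩ := hle hx
    refine ⟨⟨_, hdet⟩, ?_, rfl⟩
    rw [h]
    exact mem_map_slConj hm rfl
  · rintro _ ⟨g, hg, rfl⟩
    exact ⟨Subring.subset_closure ⟨g, hg, rfl⟩, g.2⟩

end Conjugation

/-! ### Integral models up to scalars -/

section IntegralModel

/-- Matrices over `ℝ` with the traces of integral matrices, up to scalars, are simultaneously
conjugate to multiples of these. -/
theorem exists_smul_eq_intConj {α β : SL2R} {x y z s t : ℝ} (h : HasTraces α β x y z)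
    {A B : M2Z} (hs : s ≠ 0) (ht : t ≠ 0) (hA : (A.det : ℝ) = s ^ 2) (hB : (B.det : ℝ) = t ^ 2)
    (htA : (A.trace : ℝ) = s * x) (htB : (B.trace : ℝ) = t * y)
    (htAB : ((A * B).trace : ℝ) = s * t * z) (hyp : 4 ≤ x ^ 2)
    (hirr : x ^ 2 + y ^ 2 + z ^ 2 - x * y * z ≠ 4) :
    ∃ P : M2Rˣ, s • (α : M2R) = intConj P A ∧ t • (β : M2R) = intConj P B := by
  obtain ⟨rfl, rfl, rfl⟩ := h
  let f : M2Z →+* M2R := (Int.castRingHom ℝ).mapMatrix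
  have hdet (m : M2Z) : (f m).det = m.det := (RingHom.map_det (Int.castRingHom ℝ) m).symm
  have htr (m : M2Z) : (f m).trace = m.trace := (AddMonoidHom.map_trace (Int.castAddHom ℝ) m).symm
  obtain ⟨P, h1, h2⟩ := exists_conj_of_trace_eq (A := (α : M2R)) (B := (β : M2R))
    (A' := s⁻¹ • f A) (B' := t⁻¹ • f B) α.2 β.2
    (by rw [det_smul, hdet, hA]; simp [hs])
    (by rw [det_smul, hdet, hB]; simp [ht])
    (by rw [trace_smul, htr, htA, smul_eq_mul, inv_mul_cancel_left₀ hs])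
    (by rw [trace_smul, htr, htB, smul_eq_mul, inv_mul_cancel_left₀ ht])
    (by
      rw [smul_mul_smul_comm, ← map_mul, trace_smul, htr, htAB, smul_eq_mul, ← mul_inv,
        inv_mul_cancel_left₀ (mul_ne_zero hs ht), Matrix.SpecialLinearGroup.coe_mul])
    hyp hirr
  refine ⟨P, ?_, ?_⟩
  · rw [h1, mul_smul_comm, smul_mul_assoc, smul_inv_smul₀ hs]
    rfl
  · rw [h2, mul_smul_comm, smul_mul_assoc, smul_inv_smul₀ ht]
    rfl

/-- Removes the square roots: in products such as `α²` the scalars multiply to an integer, which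
also divides the integral matrix. -/
theorem eq_intConj_of_smul_eq {P : M2Rˣ} {X : M2R} {Y Z : M2Z} {r : ℝ} {d : ℤ} (hr : r = d)
    (hd : d ≠ 0) (h : r • X = intConj P Y) (hYZ : Y = d • Z) : X = intConj P Z := by
  rw [hYZ, map_zsmul, hr, ← Int.cast_smul_eq_zsmul ℝ] at h
  exact smul_right_injective _ (Int.cast_ne_zero.mpr hd) h

theorem smul_mul_eq_intConj {P : M2Rˣ} {g h : SL2R} {A B : M2Z} {s t : ℝ}
    (hg : s • (g : M2R) = intConj P A) (hh : t • (h : M2R) = intConj P B) :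
    (s * t) • ((g * h : SL2R) : M2R) = intConj P (A * B) := by
  rw [Matrix.SpecialLinearGroup.coe_mul, map_mul, ← hg, ← hh, smul_mul_smul_comm]

/-- Scalars cancel in conjugation, so `g` acts as `A` does. Writing the condition as `A * m = m' *
A` avoids inverting `A` over ℤ. -/
theorem conj_mem_map_slConj {P : M2Rˣ} {O : Subring M2Z} {g : SL2R} {A : M2Z} {s : ℝ} (hs : s ≠ 0)
    (hg : s • (g : M2R) = intConj P A) (hA : ∀ m ∈ O, ∃ m' ∈ O, A * m = m' * A) :
    ∀ u ∈ (unitsNormOne O).map (slConj P), g * u * g⁻¹ ∈ (unitsNormOne O).map (slConj P) := by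
  rintro _ ⟨m, hm, rfl⟩
  obtain ⟨m', hm', h⟩ := hA m hm
  refine mem_map_slConj hm' ?_
  have key : (g : M2R) * intConj P m = intConj P m' * g := by
    refine smul_right_injective _ hs ?_
    change s • _ = s • _
    rw [← smul_mul_assoc, ← mul_smul_comm, hg, ← map_mul, ← map_mul, h]
  rw [Matrix.SpecialLinearGroup.coe_mul, Matrix.SpecialLinearGroup.coe_mul, coe_slConj, key, mul_assoc,
    ← Matrix.SpecialLinearGroup.coe_mul, mul_inv_cancel, Matrix.SpecialLinearGroup.coe_one, mul_one]

end IntegralModel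

/-! ### Congruence orders -/

section Order

/-- The order of all integral matrices with entries `a, b, c, d` such that `c ≡ p b mod N` and
`d ≡ a + q b mod M`. -/
def congrOrder (p q N M : ℤ) (hN : N ∣ p * M) (hM : M ∣ N) : Subring M2Z where
  carrier := {m | N ∣ m 1 0 - p * m 0 1 ∧ M ∣ m 1 1 - m 0 0 - q * m 0 1}
  zero_mem' := by simp
  one_mem' := by simp
  add_mem' {m n} := by
    rintro ⟨⟨l, hl⟩, ⟨k, hk⟩⟩ ⟨⟨l', hl'⟩, ⟨k', hk'⟩⟩
    refine ⟨⟨l + l', ?_⟩, ⟨k + k', ?_⟩⟩ <;> simp only [Matrix.add_apply]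
    · linear_combination hl + hl'
    · linear_combination hk + hk'
  neg_mem' {m} := by
    rintro ⟨⟨l, hl⟩, ⟨k, hk⟩⟩
    refine ⟨⟨-l, ?_⟩, ⟨-k, ?_⟩⟩ <;> simp only [Matrix.neg_apply]
    · linear_combination -hl
    · linear_combination -hk
  mul_mem' {m n} := by
    rintro ⟨⟨l, hl⟩, ⟨k, hk⟩⟩ ⟨⟨l', hl'⟩, ⟨k', hk'⟩⟩
    obtain ⟨e, he⟩ := hN
    obtain ⟨f, hf⟩ := hM
    refine ⟨⟨l * n 0 0 + m 1 1 * l' + e * (k * n 0 1 - m 0 1 * k'), ?_⟩,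
      ⟨f * (l * n 0 1 - m 0 1 * l') + k * n 0 0 + m 1 1 * k' +
        q * (n 0 1 * k - m 0 1 * k'), ?_⟩⟩
    · simp only [Matrix.mul_apply, Fin.sum_univ_two]
      linear_combination n 0 0 * hl + m 1 1 * hl' + p * n 0 1 * hk - p * m 0 1 * hk'
        + (k * n 0 1 - m 0 1 * k') * he
    · simp only [Matrix.mul_apply, Fin.sum_univ_two]
      linear_combination n 0 1 * hl - m 0 1 * hl' + n 0 0 * hk + m 1 1 * hk' + q * n 0 1 * hk - q * m 0 1 * hk'
        + (l * n 0 1 - m 0 1 * l') * hf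

theorem mem_congrOrder {p q N M : ℤ} {hN : N ∣ p * M} {hM : M ∣ N} {m : M2Z} :
    m ∈ congrOrder p q N M hN hM ↔
      N ∣ m 1 0 - p * m 0 1 ∧ M ∣ m 1 1 - m 0 0 - q * m 0 1 := Iff.rfl

/-- Free integral coordinates, which turn stability under conjugation into polynomial identities. -/
theorem mem_congrOrder_iff_exists {p q N M : ℤ} {hN : N ∣ p * M} {hM : M ∣ N} {m : M2Z} :
    m ∈ congrOrder p q N M hN hM ↔
      ∃ a b l k : ℤ, m = !![a, b; p * b + N * l, a + q * b + M * k] := by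
  constructor
  · rintro ⟨⟨l, hl⟩, ⟨k, hk⟩⟩
    refine ⟨m 0 0, m 0 1, l, k, ?_⟩
    rw [← hl, ← hk, add_sub_cancel, add_assoc, add_sub_cancel, add_sub_cancel]
    exact eta_fin_two m
  · rintro ⟨a, b, l, k, rfl⟩
    exact ⟨⟨l, by simp⟩, ⟨k, by simp; ring⟩⟩

end Order

/-! ### Generation by coset enumeration in SL₂(ℤ) -/

section CosetTable

/-- The letter with number `c` in the alphabet that consists of the entries of `L`
(with even numbers) and of their adjugates (with odd numbers). -/
def letter (L : List M2Z) (c : ℕ) : M2Z :=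
  -- The default `1` makes every number a valid letter, so words need no bound on their entries.
  let m := L.getD (c / 2) 1
  if c % 2 = 0 then m else !![m 1 1, -m 0 1; -m 1 0, m 0 0]

/-- The value of a word in the entries of `L` and their adjugates. -/
def wordProd (L : List M2Z) (w : List ℕ) : M2Z := (w.map (letter L)).prod

theorem exists_mem_coe_eq_wordProd {K : Subgroup SL2Z} {L : List M2Z}
    (hL : ∀ m ∈ L, ∃ g ∈ K, (g : M2Z) = m) (w : List ℕ) :
    ∃ g ∈ K, (g : M2Z) = wordProd L w := by
  have hletter (c : ℕ) : ∃ g ∈ K, (g : M2Z) = letter L c := by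
    obtain ⟨g, hg, h⟩ : ∃ g ∈ K, (g : M2Z) = L.getD (c / 2) 1 := by
      by_cases hc : c / 2 < L.length
      · rw [List.getD_eq_getElem _ _ hc]
        exact hL _ (List.getElem_mem hc)
      · rw [List.getD_eq_default _ _ (not_lt.mp hc)]
        exact ⟨1, one_mem _, rfl⟩
    unfold letter
    rw [← h]
    by_cases hc : c % 2 = 0
    · exact ⟨g, hg, by simp [hc]⟩
    · refine ⟨g⁻¹, inv_mem hg, ?_⟩
      rw [Matrix.SpecialLinearGroup.coe_inv, adjugate_fin_two]
      simp [hc]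
  induction w with
  | nil => exact ⟨1, one_mem _, rfl⟩
  | cons c w ih =>
    obtain ⟨g, hg, h⟩ := hletter c
    obtain ⟨g', hg', h'⟩ := ih
    refine ⟨g * g', mul_mem hg hg', ?_⟩
    rw [Matrix.SpecialLinearGroup.coe_mul, h, h']
    simp [wordProd]

/-- A coset table of `SL₂(ℤ)` modulo `K`, given by coset representatives `R` and by the action of
the generators `S` and `T`. If no representative but the first one lies in `U`, then `U ≤ K`. -/
theorem le_of_cosetTable {U K : Subgroup SL2Z} (hKU : K ≤ U) {L : List M2Z}
    (hL : ∀ m ∈ L, ∃ g ∈ K, (g : M2Z) = m) {n : ℕ} {R : Fin (n + 1) → M2Z} (hR0 : R 0 = 1)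
    (hdet : ∀ i, R i 0 0 * R i 1 1 - R i 0 1 * R i 1 0 = 1)
    (hU : ∀ g ∈ U, ∀ i, (g : M2Z) = R i → i = 0)
    {jS jT : Fin (n + 1) → Fin (n + 1)} {wS wT : Fin (n + 1) → List ℕ}
    (hS : ∀ i, R i * !![0, -1; 1, 0] = wordProd L (wS i) * R (jS i))
    (hT : ∀ i, R i * !![1, 1; 0, 1] = wordProd L (wT i) * R (jT i)) : U ≤ K := by
  let r (i : Fin (n + 1)) : SL2Z := ⟨R i, by rw [det_fin_two]; exact hdet i⟩
  -- The union of the listed cosets of `K`; being stable under `S` and `T`, it is all of SL₂(ℤ).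
  let X : Set SL2Z := {g | ∃ k ∈ K, ∃ i, g = k * r i}
  have step {s : SL2Z} {j : Fin (n + 1) → Fin (n + 1)} {w : Fin (n + 1) → List ℕ}
      (h : ∀ i, R i * s = wordProd L (w i) * R (j i)) : ∀ g ∈ X, g * s ∈ X := by
    rintro _ ⟨k, hk, i, rfl⟩
    obtain ⟨k', hk', h'⟩ := exists_mem_coe_eq_wordProd hL (w i)
    refine ⟨k * k', mul_mem hk hk', j i, ?_⟩
    rw [mul_assoc, mul_assoc]
    congr 1
    apply Subtype.ext
    rw [Matrix.SpecialLinearGroup.coe_mul, Matrix.SpecialLinearGroup.coe_mul, h']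
    exact h i
  have hXS : ∀ g ∈ X, g * ModularGroup.S ∈ X := step hS
  have hXT : ∀ g ∈ X, g * ModularGroup.T ∈ X := step hT
  have hX (g : SL2Z) : g ∈ X := by
    have hg : g ∈ Subgroup.closure {ModularGroup.S, ModularGroup.T} := by
      rw [SpecialLinearGroup.SL2Z_generators]
      trivial
    induction hg using Subgroup.closure_induction_right with
    | one => exact ⟨1, one_mem _, 0, by rw [one_mul]; exact Subtype.ext hR0.symm⟩
    | mul_right x y _ hy hx =>
      rcases hy with rfl | rfl
      exacts [hXS _ hx, hXT _ hx]
    | mul_inv_cancel x y _ hy hx =>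
      rcases hy with rfl | rfl
      -- Stability is known only for `S` and `T`, so their inverses are written as positive words.
      · rw [show (ModularGroup.S)⁻¹ = ModularGroup.S * ModularGroup.S * ModularGroup.S by
          decide +kernel]
        simp only [← mul_assoc]
        exact hXS _ (hXS _ (hXS _ hx))
      · rw [show (ModularGroup.T)⁻¹ = ModularGroup.S * ModularGroup.S * ModularGroup.S *
          ModularGroup.T * ModularGroup.S * ModularGroup.T * ModularGroup.S by decide +kernel]
        simp only [← mul_assoc]
        exact hXS _ (hXT _ (hXS _ (hXT _ (hXS _ (hXS _ (hXS _ hx))))))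
  intro g hg
  obtain ⟨k, hk, i, rfl⟩ := hX g
  have hi : r i ∈ U := by simpa using mul_mem (inv_mem (hKU hk)) hg
  have h0 := hU _ hi i rfl
  have h1 : r i = 1 := Subtype.ext (by simp [r, h0, hR0])
  rwa [h1, mul_one]

end CosetTable

/-! ### The three coset tables -/

/-- Generators of the group of norm one elements of an order of index `20` in `M₂(ℤ)`. -/
theorem unitsNormOne_five_le {K : Subgroup SL2Z}
    (hK : K ≤ unitsNormOne (congrOrder 5 1 10 2 (by norm_num) (by norm_num)))
    (hL : ∀ m ∈ [!![-2, -1; 15, 7], !![-1, -1; 5, 4], !![9, 4; 20, 9],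
      -1], ∃ g ∈ K, (g : M2Z) = m) :
    unitsNormOne (congrOrder 5 1 10 2 (by norm_num) (by norm_num)) ≤ K := by
  -- `jS`, `jT` give the target coset and `wS`, `wT` the correcting word; letters 0, 2, 4, 6 are the
  -- entries of the list, 6 being -1, and odd letters their inverses.
  refine le_of_cosetTable hK hL (n := 11)
    (R := ![!![1, 0; 0, 1], !![1, 1; 0, 1], !![0, -1; 1, 0], !![1, -1; 1, 0], !![0, -1; 1, 1],
      !![0, -1; 1, -1], !![1, 0; 1, 1], !![1, -2; 1, -1], !![0, -1; 1, 2], !![0, -1; 1, -2],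
      !![1, 1; 1, 2], !![1, -3; 1, -2]])
    (jS := ![2, 3, 0, 1, 7, 6, 5, 4, 10, 11, 8, 9])
    (jT := ![1, 0, 4, 6, 8, 2, 10, 3, 11, 5, 9, 7])
    (wS := ![[], [], [6], [6], [3, 0, 0, 5, 6], [6], [], [4, 1, 1, 2], [0, 5, 6], [4, 0, 5, 6],
      [4, 1], [4, 1, 5]])
    (wT := ![[], [4, 1, 1, 2, 6], [], [], [], [], [], [], [0, 0, 5], [], [4, 1, 3, 0, 5, 6], []])
    (by decide +kernel) (by decide +kernel) (fun g hg i hi => ?_) (by decide +kernel)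
    (by decide +kernel)
  rw [mem_unitsNormOne, hi, mem_congrOrder] at hg
  clear hi
  revert i
  decide +kernel

/-- Generators of the group of norm one elements of an order of index `144` in `M₂(ℤ)`. -/
theorem unitsNormOne_six_le {K : Subgroup SL2Z}
    (hK : K ≤ unitsNormOne (congrOrder 3 0 12 12 (by norm_num) (by norm_num)))
    (hL : ∀ m ∈ [!![2, -1; -3, 2], !![-1, -2; 6, 11], !![-4, -9; 9, 20], !![2, -3; -9, 14],
      !![4, -7; -9, 16], -1], ∃ g ∈ K, (g : M2Z) = m) :
    unitsNormOne (congrOrder 3 0 12 12 (by norm_num) (by norm_num)) ≤ K := by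
  refine le_of_cosetTable hK hL (n := 23)
    (R := ![!![1, 0; 0, 1], !![1, 1; 0, 1], !![1, -1; 0, 1], !![0, -1; 1, 0], !![1, 2; 0, 1],
      !![1, -1; 1, 0], !![-1, -1; 1, 0], !![0, -1; 1, 1], !![0, -1; 1, -1], !![2, -1; 1, 0],
      !![1, 0; 1, 1], !![1, -2; 1, -1], !![-1, -2; 1, 1], !![-1, 0; 1, -1], !![0, -1; 1, 2],
      !![0, -1; 1, -2], !![2, 1; 1, 1], !![2, -3; 1, -1], !![0, -1; 1, 3], !![0, -1; 1, -3],
      !![2, 3; 1, 2], !![2, -5; 1, -2], !![-1, 0; 3, -1], !![-1, 0; -3, -1]])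
    (jS := ![3, 5, 6, 0, 9, 1, 2, 13, 10, 4, 8, 16, 17, 7, 15, 14, 11, 12, 22, 23, 21, 20, 18, 19])
    (jT := ![1, 4, 0, 7, 2, 10, 12, 14, 3, 16, 13, 5, 11, 6, 18, 8, 20, 9, 21, 15, 19, 17, 23, 22])
    (wS := ![[], [], [], [10], [], [10], [10], [], [10], [10], [], [10], [5, 8, 10], [10], [0],
      [1, 10], [], [9, 4], [], [], [7, 2, 5, 8], [9, 4, 3, 6, 10], [10], [10]])
    (wT := ![[], [], [], [], [9, 4, 10], [], [], [], [], [], [1, 10], [], [3, 6], [], [], [], [],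
      [], [2, 5, 8], [], [9, 0, 10], [], [0, 10], [1, 8, 7]])
    (by decide +kernel) (by decide +kernel) (fun g hg i hi => ?_) (by decide +kernel)
    (by decide +kernel)
  rw [mem_unitsNormOne, hi, mem_congrOrder] at hg
  clear hi
  revert i
  decide +kernel

/-- Generators of the group of norm one elements of an order of index `32` in `M₂(ℤ)`. -/
theorem unitsNormOne_two_le {K : Subgroup SL2Z}
    (hK : K ≤ unitsNormOne (congrOrder 2 2 8 4 (by norm_num) (by norm_num)))
    (hL : ∀ m ∈ [!![1, -1; -2, 3], !![-1, -2; 4, 7], !![3, -2; -4, 3],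
      -1], ∃ g ∈ K, (g : M2Z) = m) :
    unitsNormOne (congrOrder 2 2 8 4 (by norm_num) (by norm_num)) ≤ K := by
  refine le_of_cosetTable hK hL (n := 11)
    (R := ![!![1, 0; 0, 1], !![1, 1; 0, 1], !![1, -1; 0, 1], !![0, -1; 1, 0], !![1, 2; 0, 1],
      !![1, -1; 1, 0], !![-1, -1; 1, 0], !![0, -1; 1, 1], !![0, -1; 1, -1], !![2, -1; 1, 0],
      !![1, 0; 1, 1], !![-1, 0; 1, -1]])
    (jS := ![3, 5, 6, 0, 9, 1, 2, 11, 10, 4, 8, 7])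
    (jT := ![1, 4, 0, 7, 2, 10, 8, 5, 3, 11, 9, 6])
    (wS := ![[], [], [], [6], [], [6], [6], [], [6], [6], [], [6]])
    (wT := ![[], [], [], [], [1, 4, 1, 2, 6], [], [3, 0], [0], [], [1, 6], [5, 0], []])
    (by decide +kernel) (by decide +kernel) (fun g hg i hi => ?_) (by decide +kernel)
    (by decide +kernel)
  rw [mem_unitsNormOne, hi, mem_congrOrder] at hg
  clear hi
  revert i
  decide +kernel

/-! ### From generators of the norm one group to the equality -/

section Assembly

variable {α β : SL2R} {P : M2Rˣ} {O : Subring M2Z}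

theorem neg_one_mem_map_slConj : (-1 : SL2R) ∈ (unitsNormOne O).map (slConj P) :=
  mem_map_slConj (O.neg_mem O.one_mem) (by
    rw [map_neg, map_one, Matrix.SpecialLinearGroup.coe_neg, Matrix.SpecialLinearGroup.coe_one])

theorem saturate_le {H U : Subgroup SL2R} (hH : H ≤ U) (h : -1 ∈ U) : saturate H ≤ U :=
  sup_le hH ((Subgroup.closure_le U).mpr (Set.singleton_subset_iff.mpr h))

theorem le_saturate {H : Subgroup SL2R} : H ≤ saturate H := le_sup_left

theorem neg_one_mem_saturate {H : Subgroup SL2R} : -1 ∈ saturate H :=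
  Subgroup.mem_sup_right (Subgroup.subset_closure rfl)

theorem left_mem_Gam : α ∈ Gam α β :=
  le_saturate (Subgroup.subset_closure (Set.mem_insert _ _))

theorem right_mem_Gam : β ∈ Gam α β :=
  le_saturate (Subgroup.subset_closure (Set.mem_insert_of_mem _ rfl))

theorem sq_mem_GamSq {g : SL2R} (hg : g ∈ Gam α β) : g ^ 2 ∈ GamSq α β :=
  Subgroup.subset_closure ⟨g, hg, rfl⟩

/-- As -1 lies in `U`, the group `Γ` lies in the join of `U` with the group generated by `α` and
`β`, where `sq_mem_of_mem_closure` applies. -/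
theorem GamSq_le {U : Subgroup SL2R} (hα : ∀ u ∈ U, α * u * α⁻¹ ∈ U)
    (hβ : ∀ u ∈ U, β * u * β⁻¹ ∈ U) (hα2 : α ^ 2 ∈ U) (hβ2 : β ^ 2 ∈ U)
    (hαβ2 : (α * β) ^ 2 ∈ U) (h1 : -1 ∈ U) : GamSq α β ≤ U := by
  refine (Subgroup.closure_le U).mpr ?_
  rintro _ ⟨g, hg, rfl⟩
  exact sq_mem_of_mem_closure hα hβ hα2 hβ2 hαβ2
    (saturate_le le_sup_left (Subgroup.mem_sup_right h1) hg)

/-- If a group `H` between `±1` and the conjugate of the norm one group of an order contains the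
conjugates of generators of the latter, it is the norm one group of the order it generates. -/
theorem normOneEqSelf_of_generators {H : Subgroup SL2R} {L : List M2Z}
    (hH : H ≤ (unitsNormOne O).map (slConj P)) (hL : ∀ m ∈ L, ∃ g ∈ H, (g : M2R) = intConj P m)
    (hgen : ∀ K ≤ unitsNormOne O, (∀ m ∈ L, ∃ g ∈ K, (g : M2Z) = m) → unitsNormOne O ≤ K) :
    NormOneEqSelf H := by
  refine normOneEqSelf_of_eq_map (le_antisymm hH (Subgroup.map_le_iff_le_comap.mpr ?_))
  -- The generation hypothesis is applied to the part of the norm one group that conjugation sends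
  -- into `H`.
  refine le_trans (hgen (H.comap (slConj P) ⊓ unitsNormOne O) inf_le_right ?_) inf_le_left
  intro m hm
  obtain ⟨g, hg, h⟩ := hL m hm
  obtain ⟨k, rfl, rfl⟩ := exists_slConj_eq h
  obtain ⟨k', hk', h'⟩ := hH hg
  have : k = k' := by
    apply Subtype.ext
    have h2 := congrArg (fun g : SL2R => (g : M2R)) h'
    have hinj : Function.Injective (intConj P) :=
      (MulAction.injective (ConjAct.toConjAct P)).comp
        (Matrix.map_injective (Int.cast_injective (α := ℝ)))
    exact hinj h2.symm
  exact ⟨k, ⟨hg, this ▸ hk'⟩, rfl⟩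

end Assembly

/-! ### The three cases -/

section Cases

/-- A matrix that multiplies a parametrized element of an order as prescribed conjugates the order
into itself. -/
theorem exists_mul_eq_mul {p q N M : ℤ} {hN : N ∣ p * M} {hM : M ∣ N} {A : M2Z}
    (a' b' l' k' : ℤ → ℤ → ℤ → ℤ → ℤ)
    (h : ∀ a b l k, A * !![a, b; p * b + N * l, a + q * b + M * k] =
      !![a' a b l k, b' a b l k; p * b' a b l k + N * l' a b l k,
        a' a b l k + q * b' a b l k + M * k' a b l k] * A) :
    ∀ m ∈ congrOrder p q N M hN hM, ∃ m' ∈ congrOrder p q N M hN hM, A * m = m' * A := by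
  intro m hm
  obtain ⟨a, b, l, k, rfl⟩ := mem_congrOrder_iff_exists.mp hm
  exact ⟨_, mem_congrOrder_iff_exists.mpr ⟨_, _, _, _, rfl⟩, h a b l k⟩

/-- Criterion for the group generated by `Γ⁽²⁾`, `αβ` and `-1`. -/
theorem normOneEqSelf_saturate_sup {α β : SL2R} {P : M2Rˣ} {O : Subring M2Z} {s t : ℝ}
    {A B C A₂ B₂ : M2Z} {d e f : ℤ} (hα : s • (α : M2R) = intConj P A)
    (hβ : t • (β : M2R) = intConj P B) (hd : d ≠ 0) (he : e ≠ 0) (hf : f ≠ 0)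
    (hsd : s * s = d) (hte : t * t = e) (hstf : s * t = f)
    (hA₂ : A * A = d • A₂) (hB₂ : B * B = e • B₂) (hC : A * B = f • C)
    (hA₂O : A₂ ∈ O) (hB₂O : B₂ ∈ O) (hCO : C ∈ O)
    (hAO : ∀ m ∈ O, ∃ m' ∈ O, A * m = m' * A) (hBO : ∀ m ∈ O, ∃ m' ∈ O, B * m = m' * B)
    (hgen : ∀ K ≤ unitsNormOne O, (∀ m ∈ [C, A₂, B₂, -1], ∃ g ∈ K, (g : M2Z) = m) →
      unitsNormOne O ≤ K) :
    NormOneEqSelf (saturate (GamSq α β ⊔ Subgroup.closure {α * β})) := by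
  have hs : s ≠ 0 := by rintro rfl; simp [eq_comm, hd] at hsd
  have ht : t ≠ 0 := by rintro rfl; simp [eq_comm, he] at hte
  have hα2 : ((α ^ 2 : SL2R) : M2R) = intConj P A₂ := by
    rw [pow_two]
    exact eq_intConj_of_smul_eq hsd hd (smul_mul_eq_intConj hα hα) hA₂
  have hβ2 : ((β ^ 2 : SL2R) : M2R) = intConj P B₂ := by
    rw [pow_two]
    exact eq_intConj_of_smul_eq hte he (smul_mul_eq_intConj hβ hβ) hB₂
  have hαβ : ((α * β : SL2R) : M2R) = intConj P C :=
    eq_intConj_of_smul_eq hstf hf (smul_mul_eq_intConj hα hβ) hC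
  have hU := mem_map_slConj hCO hαβ
  refine normOneEqSelf_of_generators (P := P) (O := O) ?_ ?_ hgen
  · refine saturate_le (sup_le ?_ ?_) neg_one_mem_map_slConj
    · exact GamSq_le (conj_mem_map_slConj hs hα hAO) (conj_mem_map_slConj ht hβ hBO)
        (mem_map_slConj hA₂O hα2) (mem_map_slConj hB₂O hβ2) (pow_mem hU 2) neg_one_mem_map_slConj
    · exact (Subgroup.closure_le _).mpr (Set.singleton_subset_iff.mpr hU)
  · simp only [List.forall_mem_cons]
    refine ⟨⟨_, ?_, hαβ⟩, ⟨_, ?_, hα2⟩, ⟨_, ?_, hβ2⟩, ⟨-1, neg_one_mem_saturate, ?_⟩, by simp⟩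
    · exact le_saturate (Subgroup.mem_sup_right (Subgroup.subset_closure rfl))
    · exact le_saturate (Subgroup.mem_sup_left (sq_mem_GamSq left_mem_Gam))
    · exact le_saturate (Subgroup.mem_sup_left (sq_mem_GamSq right_mem_Gam))
    · rw [map_neg, map_one, Matrix.SpecialLinearGroup.coe_neg, Matrix.SpecialLinearGroup.coe_one]

/-- Criterion for the group generated by `Γ⁽²⁾` and `-1`. -/
theorem normOneEqSelf_saturate_GamSq {α β : SL2R} {P : M2Rˣ} {O : Subring M2Z} {s t : ℝ}
    {A B A₂ B₂ D E F : M2Z} {d e : ℤ} (hα : s • (α : M2R) = intConj P A)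
    (hβ : t • (β : M2R) = intConj P B) (hd : d ≠ 0) (he : e ≠ 0)
    (hsd : s * s = d) (hte : t * t = e)
    (hA₂ : A * A = d • A₂) (hB₂ : B * B = e • B₂) (hD : A * B * (A * B) = (d * e) • D)
    (hE : B * A * (B * A) = (d * e) • E) (hF : A * B * (B * A) = (d * e) • F)
    (hA₂O : A₂ ∈ O) (hB₂O : B₂ ∈ O) (hDO : D ∈ O)
    (hAO : ∀ m ∈ O, ∃ m' ∈ O, A * m = m' * A) (hBO : ∀ m ∈ O, ∃ m' ∈ O, B * m = m' * B)
    (hgen : ∀ K ≤ unitsNormOne O, (∀ m ∈ [A₂, B₂, D, E, F, -1], ∃ g ∈ K, (g : M2Z) = m) →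
      unitsNormOne O ≤ K) :
    NormOneEqSelf (saturate (GamSq α β)) := by
  have hs : s ≠ 0 := by rintro rfl; simp [eq_comm, hd] at hsd
  have ht : t ≠ 0 := by rintro rfl; simp [eq_comm, he] at hte
  have hde : d * e ≠ 0 := mul_ne_zero hd he
  have hα2 : ((α ^ 2 : SL2R) : M2R) = intConj P A₂ := by
    rw [pow_two]
    exact eq_intConj_of_smul_eq hsd hd (smul_mul_eq_intConj hα hα) hA₂
  have hβ2 : ((β ^ 2 : SL2R) : M2R) = intConj P B₂ := by
    rw [pow_two]
    exact eq_intConj_of_smul_eq hte he (smul_mul_eq_intConj hβ hβ) hB₂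
  have hαβ := smul_mul_eq_intConj hα hβ
  have hβα := smul_mul_eq_intConj hβ hα
  have hαβ2 : (((α * β) ^ 2 : SL2R) : M2R) = intConj P D := by
    rw [pow_two]
    refine eq_intConj_of_smul_eq ?_ hde (smul_mul_eq_intConj hαβ hαβ) hD
    rw [mul_mul_mul_comm, hsd, hte, Int.cast_mul]
  have hβα2 : (((β * α) ^ 2 : SL2R) : M2R) = intConj P E := by
    rw [pow_two]
    refine eq_intConj_of_smul_eq ?_ hde (smul_mul_eq_intConj hβα hβα) hE
    rw [mul_mul_mul_comm, hsd, hte, Int.cast_mul, mul_comm]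
  have hαβ2α : ((α * β * (β * α) : SL2R) : M2R) = intConj P F := by
    refine eq_intConj_of_smul_eq ?_ hde (smul_mul_eq_intConj hαβ hβα) hF
    rw [mul_comm t s, mul_mul_mul_comm, hsd, hte, Int.cast_mul]
  have hαG : α ∈ Gam α β := left_mem_Gam
  have hβG : β ∈ Gam α β := right_mem_Gam
  refine normOneEqSelf_of_generators (P := P) (O := O) ?_ ?_ hgen
  · refine saturate_le ?_ neg_one_mem_map_slConj
    exact GamSq_le (conj_mem_map_slConj hs hα hAO) (conj_mem_map_slConj ht hβ hBO)
      (mem_map_slConj hA₂O hα2) (mem_map_slConj hB₂O hβ2) (mem_map_slConj hDO hαβ2)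
      neg_one_mem_map_slConj
  · simp only [List.forall_mem_cons]
    refine ⟨⟨_, ?_, hα2⟩, ⟨_, ?_, hβ2⟩, ⟨_, ?_, hαβ2⟩, ⟨_, ?_, hβα2⟩, ⟨_, ?_, hαβ2α⟩,
      ⟨-1, neg_one_mem_saturate, ?_⟩, by simp⟩
    · exact le_saturate (sq_mem_GamSq hαG)
    · exact le_saturate (sq_mem_GamSq hβG)
    · exact le_saturate (sq_mem_GamSq (mul_mem hαG hβG))
    · exact le_saturate (sq_mem_GamSq (mul_mem hβG hαG))
    -- `αβ²α` is not visibly a square, but it is a product of two squares from `Γ`.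
    · rw [show α * β * (β * α) = (α * β * α⁻¹) ^ 2 * α ^ 2 by simp only [pow_two]; group]
      exact le_saturate (mul_mem (sq_mem_GamSq (mul_mem (mul_mem hαG hβG) (inv_mem hαG)))
        (sq_mem_GamSq hαG))
    · rw [map_neg, map_one, Matrix.SpecialLinearGroup.coe_neg, Matrix.SpecialLinearGroup.coe_one]

/-- The model scales both matrices by √5, giving determinants 5, 5 and traces 5, 10, with 25 for the
product. -/
theorem normOneEqSelf_of_trace_sqrt_five {α β : SL2R} (h : HasTraces α β √5 (2 * √5) 5) :
    NormOneEqSelf (saturate (GamSq α β ⊔ Subgroup.closure {α * β})) := by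
  have h5 : √5 * √5 = (5 : ℝ) := Real.mul_self_sqrt (by norm_num)
  have h0 : √5 ≠ (0 : ℝ) := by positivity
  obtain ⟨P, hα, hβ⟩ := exists_smul_eq_intConj h (A := !![0, -1; 5, 5]) (B := !![5, 2; 10, 5])
    h0 h0 (by simp) (by simp) (by simp [trace_fin_two])
    (by simp [trace_fin_two]; linarith) (by simp [trace_fin_two, h5]; norm_num) (by simp; norm_num)
    (by
      rw [show √5 ^ 2 + (2 * √5) ^ 2 + 5 ^ 2 - √5 * (2 * √5) * 5 = (0 : ℝ)
        by linear_combination -5 * h5]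
      norm_num)
  refine normOneEqSelf_saturate_sup (O := congrOrder 5 1 10 2 (by norm_num) (by norm_num))
    (C := !![-2, -1; 15, 7]) (A₂ := !![-1, -1; 5, 4]) (B₂ := !![9, 4; 20, 9])
    (d := 5) (e := 5) (f := 5) hα hβ (by norm_num) (by norm_num) (by norm_num)
    (by exact_mod_cast h5) (by exact_mod_cast h5) (by exact_mod_cast h5)
    (by decide +kernel) (by decide +kernel) (by decide +kernel)
    (by rw [mem_congrOrder]; decide) (by rw [mem_congrOrder]; decide)
    (by rw [mem_congrOrder]; decide) ?_ ?_ fun K hK hL => unitsNormOne_five_le hK hL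
  -- The linear forms are the coordinates of `A m A⁻¹` in the order; their integrality is the point.
  · refine exists_mul_eq_mul (fun a b l k => a - 4 * b - 10 * l + 2 * k) (fun a b l k => -b - 2 * l)
      (fun a b l k => 2 * b + 6 * l - k) (fun a b l k => 5 * b + 11 * l - k) fun a b l k => ?_
    ext i j
    fin_cases i <;> fin_cases j <;> simp <;> ring
  · refine exists_mul_eq_mul (fun a b l k => a - 4 * b + 20 * l - 8 * k)
      (fun a b l k => 3 * b - 8 * l + 4 * k) (fun a b l k => -2 * b + 9 * l - 4 * k)
      (fun a b l k => 3 * b - 16 * l + 7 * k) fun a b l k => ?_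
    ext i j
    fin_cases i <;> fin_cases j <;> simp <;> ring

/-- The scalars √6 and √3 have the irrational product 3√2, so `αβ` is not integral in the model; the
words used have integral scalars 6, 3 or 18. -/
theorem normOneEqSelf_of_trace_sqrt_six {α β : SL2R} (h : HasTraces α β √6 (2 * √3) (3 * √2)) :
    NormOneEqSelf (saturate (GamSq α β)) := by
  have h2 : √2 * √2 = (2 : ℝ) := Real.mul_self_sqrt (by norm_num)
  have h3 : √3 * √3 = (3 : ℝ) := Real.mul_self_sqrt (by norm_num)
  have h6 : √6 = (√2 * √3 : ℝ) := by rw [← Real.sqrt_mul (by norm_num)]; norm_num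
  rw [h6] at h
  have h66 : √2 * √3 * (√2 * √3) = (6 : ℝ) := by linear_combination 3 * h2 + √2 * √2 * h3
  obtain ⟨P, hα, hβ⟩ := exists_smul_eq_intConj h (A := !![3, -1; -3, 3]) (B := !![0, -1; 3, 6])
    (s := √2 * √3) (t := √3) (by positivity) (by positivity)
    (by simp; linarith) (by simp) (by simp [trace_fin_two]; linarith)
    (by simp [trace_fin_two]; linarith)
    (by
      simp [trace_fin_two]
      linear_combination -9 * h2 - 3 * √2 * √2 * h3)
    (by linarith)
    (by
      rw [show (√2 * √3) ^ 2 + (2 * √3) ^ 2 + (3 * √2) ^ 2 - √2 * √3 * (2 * √3) * (3 * √2) = (0 : ℝ)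
        by linear_combination h66 + 4 * h3 + 9 * h2 - 6 * h66]
      norm_num)
  refine normOneEqSelf_saturate_GamSq (O := congrOrder 3 0 12 12 (by norm_num) (by norm_num))
    (A₂ := !![2, -1; -3, 2]) (B₂ := !![-1, -2; 6, 11]) (D := !![-4, -9; 9, 20])
    (E := !![2, -3; -9, 14]) (F := !![4, -7; -9, 16]) (d := 6) (e := 3) hα hβ
    (by norm_num) (by norm_num) (by exact_mod_cast h66) (by exact_mod_cast h3)
    (by decide +kernel) (by decide +kernel) (by decide +kernel) (by decide +kernel)
    (by decide +kernel) (by rw [mem_congrOrder]; decide) (by rw [mem_congrOrder]; decide)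
    (by rw [mem_congrOrder]; decide) ?_ ?_ fun K hK hL => unitsNormOne_six_le hK hL
  · refine exists_mul_eq_mul (fun a b l k => a - 6 * l - 6 * k) (fun a b l k => b - 2 * l - 6 * k)
      (fun a b l k => 2 * l + 3 * k) (fun a b l k => l + 2 * k) fun a b l k => ?_
    ext i j
    fin_cases i <;> fin_cases j <;> simp <;> ring
  · refine exists_mul_eq_mul (fun a b l k => a - 6 * b - 24 * l + 12 * k) (fun a b l k => -b - 4 * l)
      (fun a b l k => 3 * b + 13 * l - 6 * k) (fun a b l k => b + 4 * l - k) fun a b l k => ?_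
    ext i j
    fin_cases i <;> fin_cases j <;> simp <;> ring

/-- Both scalars are √2, with determinants 2, 2 and traces 4, 4, and 8 for the product. -/
theorem normOneEqSelf_of_trace_sqrt_two {α β : SL2R} (h : HasTraces α β (2 * √2) (2 * √2) 4) :
    NormOneEqSelf (saturate (GamSq α β ⊔ Subgroup.closure {α * β})) := by
  have h2 : √2 * √2 = (2 : ℝ) := Real.mul_self_sqrt (by norm_num)
  have h0 : √2 ≠ (0 : ℝ) := by positivity
  obtain ⟨P, hα, hβ⟩ := exists_smul_eq_intConj h (A := !![0, -1; 2, 4]) (B := !![2, -1; -2, 2])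
    h0 h0 (by simp) (by simp) (by simp [trace_fin_two]; linarith)
    (by simp [trace_fin_two]; linarith) (by simp [trace_fin_two, h2]; norm_num) (by linarith)
    (by
      rw [show (2 * √2) ^ 2 + (2 * √2) ^ 2 + 4 ^ 2 - 2 * √2 * (2 * √2) * 4 = (0 : ℝ)
        by linear_combination -8 * h2]
      norm_num)
  refine normOneEqSelf_saturate_sup (O := congrOrder 2 2 8 4 (by norm_num) (by norm_num))
    (C := !![1, -1; -2, 3]) (A₂ := !![-1, -2; 4, 7]) (B₂ := !![3, -2; -4, 3])
    (d := 2) (e := 2) (f := 2) hα hβ (by norm_num) (by norm_num) (by norm_num)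
    (by exact_mod_cast h2) (by exact_mod_cast h2) (by exact_mod_cast h2)
    (by decide +kernel) (by decide +kernel) (by decide +kernel)
    (by rw [mem_congrOrder]; decide) (by rw [mem_congrOrder]; decide)
    (by rw [mem_congrOrder]; decide) ?_ ?_ fun K hK hL => unitsNormOne_two_le hK hL
  · refine exists_mul_eq_mul (fun a b l k => a - 2 * b - 16 * l + 4 * k) (fun a b l k => -b - 4 * l)
      (fun a b l k => b + 9 * l - 2 * k) (fun a b l k => 2 * b + 10 * l - k) fun a b l k => ?_
    ext i j
    fin_cases i <;> fin_cases j <;> simp <;> ring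
  · refine exists_mul_eq_mul (fun a b l k => a - 2 * b - 8 * l - 4 * k)
      (fun a b l k => -b - 4 * l - 4 * k) (fun a b l k => b + 3 * l + 2 * k)
      (fun a b l k => 2 * b + 6 * l + 5 * k) fun a b l k => ?_
    ext i j
    fin_cases i <;> fin_cases j <;> simp <;> ring

end Cases

end OnePuncturedTorus

theorem mainTheorem5 (α β : Matrix.SpecialLinearGroup (Fin 2) ℝ) :
    (OnePuncturedTorus.HasTraces α β (Real.sqrt 5) (2 * Real.sqrt 5) 5 →
      OnePuncturedTorus.NormOneEqSelf (OnePuncturedTorus.saturate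
        (OnePuncturedTorus.GamSq α β ⊔ Subgroup.closure {α * β}))) ∧
    (OnePuncturedTorus.HasTraces α β (Real.sqrt 6) (2 * Real.sqrt 3) (3 * Real.sqrt 2) →
      OnePuncturedTorus.NormOneEqSelf (OnePuncturedTorus.saturate
        (OnePuncturedTorus.GamSq α β))) ∧
    (OnePuncturedTorus.HasTraces α β (2 * Real.sqrt 2) (2 * Real.sqrt 2) 4 →
      OnePuncturedTorus.NormOneEqSelf (OnePuncturedTorus.saturate
        (OnePuncturedTorus.GamSq α β ⊔ Subgroup.closure {α * β}))) :=
  ⟨OnePuncturedTorus.normOneEqSelf_of_trace_sqrt_five,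
    OnePuncturedTorus.normOneEqSelf_of_trace_sqrt_six,
    OnePuncturedTorus.normOneEqSelf_of_trace_sqrt_two⟩
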